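/- Let $d\in\{1,2,3\}$ and $\beta\ge 0$, and let $V\in L^2_{\rm loc}(\mathbb R^d)$ be a real-valued potential with $V\ge 0$ almost everywhere that is confining, i.e. $\lim_{|x|\to\infty}V(x)=\infty$ (as usual for an element of $L^2_{\rm loc}$, up to null sets: for every $M$ there is $R$ such that $V(x)\ge M$ for almost every $x$ with $|x|\ge R$). For $\phi:\mathbb R^d\to\mathbb C$ put $$E(\phi)=\int_{\mathbb R^d}\Big[\tfrac12|\nabla\phi(x)|^2+V(x)|\phi(x)|^2+\tfrac{\beta}{2}|\phi(x)|^4\Big]dx,$$ where $\nabla\phi$ is the weak gradient, and let $S$ be the set of all $\phi\in H^1(\mathbb R^d)$ with $\|\phi\|_{L^2}=1$ and $E(\phi)<\infty$. Let $\phi_g\in S$ be a ground state, i.e. $E(\phi_g)=\min_{\phi\in S}E(\phi)$. Then for every $\nu>0$ there exists a constant $C_\nu>0$ such that $$|\phi_g(x)|\le C_\nu e^{-\nu|x|}\qquad\text{for almost every }x\in\mathbb R^d .$$ -/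

import Mathlib

open MeasureTheory Filter Topology Set
open scoped ContDiff

noncomputable section

namespace GrossPitaevskii

/-- The Euclidean space `ℝ^d`, with its Euclidean norm and Lebesgue measure. -/
abbrev Space (d : ℕ) := EuclideanSpace ℝ (Fin d)

/-- `G` is the weak gradient of the complex-valued function `φ` on `ℝ^d`: both are locally
integrable and `∫ φ ∂ᵢη = -∫ Gᵢ η` for every test function `η ∈ C_c^∞(ℝ^d)` and every `i`. -/
def HasWeakGradient {d : ℕ} (φ : Space d → ℂ) (G : Space d → EuclideanSpace ℂ (Fin d)) : Prop :=
  LocallyIntegrable φ ∧ LocallyIntegrable G ∧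
    ∀ η : Space d → ℝ, ContDiff ℝ ∞ η → HasCompactSupport η → ∀ i : Fin d,
      ∫ x, (fderiv ℝ η x (EuclideanSpace.single i 1)) • φ x = -∫ x, η x • G x i

/-- A weak gradient is unique up to a null set. -/
theorem HasWeakGradient.ae_eq {d : ℕ} {φ : Space d → ℂ}
    {G H : Space d → EuclideanSpace ℂ (Fin d)}
    (hG : HasWeakGradient φ G) (hH : HasWeakGradient φ H) : G =ᵐ[volume] H := by
  have key : ∀ i : Fin d, ∀ᵐ x : Space d, G x i = H x i := by
    intro i
    have hGi : LocallyIntegrable (fun x => G x i) := fun x => by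
      obtain ⟨s, hs, hi⟩ := hG.2.1 x
      exact ⟨s, hs, (EuclideanSpace.proj (𝕜 := ℂ) i).integrable_comp hi⟩
    have hHi : LocallyIntegrable (fun x => H x i) := fun x => by
      obtain ⟨s, hs, hi⟩ := hH.2.1 x
      exact ⟨s, hs, (EuclideanSpace.proj (𝕜 := ℂ) i).integrable_comp hi⟩
    refine ae_eq_of_integral_contDiff_smul_eq hGi hHi fun η hη hc => ?_
    have h1 := hG.2.2 η hη hc i
    have h2 := hH.2.2 η hη hc i
    exact neg_injective (h1.symm.trans h2)
  filter_upwards [ae_all_iff.2 key] with x hx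
  ext i
  exact hx i

open Classical in
/-- The weak gradient `∇φ` (zero if `φ` is not weakly differentiable). -/
def weakGradient {d : ℕ} (φ : Space d → ℂ) : Space d → EuclideanSpace ℂ (Fin d) :=
  if h : ∃ G, HasWeakGradient φ G then h.choose else 0

theorem HasWeakGradient.weakGradient_ae_eq {d : ℕ} {φ : Space d → ℂ}
    {G : Space d → EuclideanSpace ℂ (Fin d)} (hG : HasWeakGradient φ G) :
    weakGradient φ =ᵐ[volume] G := by
  have h : ∃ G, HasWeakGradient φ G := ⟨G, hG⟩
  rw [weakGradient, dif_pos h]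
  exact h.choose_spec.ae_eq hG

/-- The Sobolev space `H¹(ℝ^d)`: `φ ∈ L²` is weakly differentiable with `∇φ ∈ L²`. -/
def MemH1 {d : ℕ} (φ : Space d → ℂ) : Prop :=
  MemLp φ 2 ∧ (∃ G, HasWeakGradient φ G) ∧ MemLp (weakGradient φ) 2

/-- `V ∈ L²_loc(ℝ^d)`. -/
def MemL2Loc {d : ℕ} (V : Space d → ℝ) : Prop :=
  ∀ K : Set (Space d), IsCompact K → MemLp V 2 (volume.restrict K)

/-- The confining condition `V(x) → ∞` as `|x| → ∞`. Since `V` is an element of `L²_loc`, null sets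
are disregarded. -/
def IsConfining {d : ℕ} (V : Space d → ℝ) : Prop :=
  ∀ M : ℝ, ∃ R : ℝ, ∀ᵐ x : Space d, R ≤ ‖x‖ → M ≤ V x

/-- The energy `E(φ) = ∫ ½|∇φ|² + ∫ V|φ|² + ∫ (β/2)|φ|⁴`. It is used on the set `unitSphere V β`
only, where all three integrals converge. -/
def energy {d : ℕ} (V : Space d → ℝ) (β : ℝ) (φ : Space d → ℂ) : ℝ :=
  (∫ x, 1 / 2 * ‖weakGradient φ x‖ ^ 2) + (∫ x, V x * ‖φ x‖ ^ 2) + ∫ x, β / 2 * ‖φ x‖ ^ 4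

/-- The set `S` of all `φ` with `‖φ‖₂ = 1` and `E(φ) < ∞`: the kinetic, the potential and the
interaction energy of `φ` are all finite. -/
def unitSphere {d : ℕ} (V : Space d → ℝ) (β : ℝ) : Set (Space d → ℂ) :=
  {φ | MemH1 φ ∧ Integrable (fun x => V x * ‖φ x‖ ^ 2) ∧
    Integrable (fun x => β / 2 * ‖φ x‖ ^ 4) ∧ ∫ x, ‖φ x‖ ^ 2 = 1}

/-- `φ` is a ground state: it lies in `S` and minimizes `E` over `S`. -/
def IsGroundState {d : ℕ} (V : Space d → ℝ) (β : ℝ) (φ : Space d → ℂ) : Prop :=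
  φ ∈ unitSphere V β ∧ ∀ χ ∈ unitSphere V β, energy V β φ ≤ energy V β χ

end GrossPitaevskii

end

/-! The density `w = |φ|²` of a ground state is a weak subsolution of a linear equation, and the
decay is read off from `w` alone; no regularity theory or Sobolev embedding enters. Multiplying `φ`
by `1 + sη`, with `η` real, smooth and bounded, and renormalizing gives an admissible competitor.
Stationarity at `s = 0` is the Euler–Lagrange equation tested against `ηφ`. Integrating by parts
through `∇|φ|² = 2 Re(φ̄∇φ)` and, for `η ≥ 0`, discarding the nonnegative terms `η|∇φ|²` and
`β|φ|⁴η` yields `Δw ≥ 4(V - μ)w` weakly (`IsGroundState.exists_subsolution`). Testing with a bounded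
regularization of `exp(a·x)`, whose Laplacian is at most `|a|²` times itself, leaves `4(V - μ) -
|a|²` as weight. Confinement makes this at least `1` outside a ball, so the exponential moments of
`w` are bounded uniformly in the regularization (`exists_integral_cutExp_mul_le`). Since `V ≥ 0`,
also `Δw ≥ -4μw`, so `exp(4μt)` times the heat average of `w` is nondecreasing in `t`. Comparing `t
→ 0` with `t = 1` bounds `w` almost everywhere by a Gaussian average
(`exists_ae_le_integral_heat_mul`). The Gaussian is dominated by the exponential weight, which turns
the moments into pointwise decay in the direction `a`. The `2d` directions `±eᵢ` suffice. -/

noncomputable section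

namespace GrossPitaevskii

variable {d : ℕ}

/-! ### Weak partial derivatives and integration by parts in `L²` -/

/-- The `i`-th partial derivative of a real-valued function. -/
def partialDeriv (i : Fin d) (η : Space d → ℝ) : Space d → ℝ :=
  fun x => fderiv ℝ η x (EuclideanSpace.single i 1)

/-- `g` is the `i`-th weak partial derivative of `u`. -/
def HasWeakPartial (i : Fin d) (u g : Space d → ℂ) : Prop :=
  ∀ η : Space d → ℝ, ContDiff ℝ ∞ η → HasCompactSupport η →
    ∫ x, partialDeriv i η x • u x = -∫ x, η x • g x

theorem contDiff_partialDeriv {i : Fin d} {η : Space d → ℝ} (hη : ContDiff ℝ ∞ η) :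
    ContDiff ℝ ∞ (partialDeriv i η) :=
  (hη.fderiv_right (m := ∞) (by simp)).clm_apply contDiff_const

theorem hasCompactSupport_partialDeriv {i : Fin d} {η : Space d → ℝ} (hη : HasCompactSupport η) :
    HasCompactSupport (partialDeriv i η) :=
  hη.fderiv_apply (𝕜 := ℝ) _

theorem partialDeriv_mul {i : Fin d} {f g : Space d → ℝ} (hf : ContDiff ℝ ∞ f)
    (hg : ContDiff ℝ ∞ g) (x : Space d) :
    partialDeriv i (fun y => f y * g y) x
      = f x * partialDeriv i g x + g x * partialDeriv i f x := by
  have hf' := (hf.differentiable (by simp)) x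
  have hg' := (hg.differentiable (by simp)) x
  simp [partialDeriv, fderiv_fun_mul hf' hg']

theorem partialDeriv_comp_sub_left {i : Fin d} {f : Space d → ℝ} (hf : ContDiff ℝ ∞ f)
    (x z : Space d) :
    partialDeriv i (fun z => f (x - z)) z = -partialDeriv i f (x - z) := by
  have h := (((hf.differentiable (by simp)) (x - z)).hasFDerivAt).comp z
    ((hasFDerivAt_id z).const_sub x)
  simp only [Function.comp_def] at h
  simp [partialDeriv, h.fderiv]

theorem partialDeriv_comp_sub_right {i : Fin d} {f : Space d → ℝ} (hf : ContDiff ℝ ∞ f)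
    (x z : Space d) :
    partialDeriv i (fun x => f (x - z)) x = partialDeriv i f (x - z) := by
  have h := (((hf.differentiable (by simp)) (x - z)).hasFDerivAt).comp x
    ((hasFDerivAt_id x).sub_const z)
  simp only [Function.comp_def, id] at h
  simp [partialDeriv, h.fderiv]

theorem HasWeakPartial.smul {i : Fin d} {u g : Space d → ℂ} {k : Space d → ℝ}
    (h : HasWeakPartial i u g) (hu : LocallyIntegrable u) (hg : LocallyIntegrable g)
    (hk : ContDiff ℝ ∞ k) :
    HasWeakPartial i (fun x => k x • u x) (fun x => k x • g x + partialDeriv i k x • u x) := by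
  intro η hη hc
  have h1 := h (fun x => η x * k x) (hη.mul hk) hc.mul_right
  have hdk : Continuous (partialDeriv i k) := (contDiff_partialDeriv hk).continuous
  have hdη : Continuous (partialDeriv i η) := (contDiff_partialDeriv hη).continuous
  have hcη := hasCompactSupport_partialDeriv (i := i) hc
  have i1 : Integrable fun x => (η x * partialDeriv i k x) • u x :=
    hu.integrable_smul_left_of_hasCompactSupport (hη.continuous.mul hdk) hc.mul_right
  have i2 : Integrable fun x => (k x * partialDeriv i η x) • u x :=
    hu.integrable_smul_left_of_hasCompactSupport (hk.continuous.mul hdη) hcη.mul_left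
  have i3 : Integrable fun x => (η x * k x) • g x :=
    hg.integrable_smul_left_of_hasCompactSupport (hη.continuous.mul hk.continuous) hc.mul_right
  simp only [partialDeriv_mul hη hk, add_smul] at h1
  rw [integral_add i1 i2] at h1
  simp only [smul_add, smul_smul]
  rw [integral_add i3 i1, neg_add, ← h1]
  simp only [mul_comm (k _)]
  abel

theorem HasWeakPartial.conj {i : Fin d} {u g : Space d → ℂ} (h : HasWeakPartial i u g) :
    HasWeakPartial i (fun x => starRingEnd ℂ (u x)) (fun x => starRingEnd ℂ (g x)) := by
  intro η hη hc
  have := congrArg (starRingEnd ℂ) (h η hη hc)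
  rw [map_neg, ← integral_conj, ← integral_conj] at this
  simpa [Complex.real_smul] using this

theorem integrable_mul_of_memLp_two {u v : Space d → ℂ} (hu : MemLp u 2) (hv : MemLp v 2) :
    Integrable fun x => u x * v x :=
  hu.integrable_mul hv

/-- Translations act continuously on `L²`, and the integral is an inner product with a translate;
`u` is conjugated because the inner product is conjugate-linear in its first slot. -/
theorem continuous_integral_translate_mul {u v : Space d → ℂ} (hu : MemLp u 2) (hv : MemLp v 2) :
    Continuous fun y => ∫ x, u (x - y) * v x := by
  have hu' : MemLp (fun x => starRingEnd ℂ (u x)) 2 := hu.star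
  have key : ∀ y : Space d, ∫ x, u (x - y) * v x
      = inner ℂ (DomAddAct.mk (-y) +ᵥ hu'.toLp (fun x => starRingEnd ℂ (u x))) (hv.toLp v) := by
    intro y
    rw [L2.inner_def]
    refine integral_congr_ae ?_
    rw [DomAddAct.mk_vadd_toLp]
    filter_upwards [MemLp.coeFn_toLp (hu'.comp_measurePreserving
      (measurePreserving_vadd (-y) volume)), hv.coeFn_toLp] with x h1 h2
    simp only [Function.comp_def] at h1
    rw [h1, h2]
    simp [mul_comm, sub_eq_neg_add]
  simp_rw [key]
  have : Fact ((2 : ENNReal) ≠ ⊤) := ⟨by simp⟩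
  refine Continuous.inner ?_ continuous_const
  exact (DomAddAct.continuous_mk.comp continuous_neg).vadd continuous_const

/-- Since `|uv| ≤ |u|² + |v|²`, the integrand is dominated by two convolution integrands of `L¹`
functions. This justifies Fubini below. -/
theorem integrable_kernel_mul_mul {ρ : Space d → ℝ} (hρ : Continuous ρ) (hc : HasCompactSupport ρ)
    {u v : Space d → ℂ} (hu : MemLp u 2) (hv : MemLp v 2) :
    Integrable (fun p : Space d × Space d => ρ (p.1 - p.2) • (u p.2 * v p.1))
      (volume.prod volume) := by
  have hρi : Integrable fun x => ‖ρ x‖ := (hρ.integrable_of_hasCompactSupport hc).norm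
  have hu2 : Integrable fun x => ‖u x‖ ^ 2 := hu.integrable_norm_pow (by simp)
  have hv2 : Integrable fun x => ‖v x‖ ^ 2 := hv.integrable_norm_pow (by simp)
  have h1 := hu2.convolution_integrand (ContinuousLinearMap.mul ℝ ℝ) hρi
  have h2 := (hv2.convolution_integrand (ContinuousLinearMap.mul ℝ ℝ) hρi.comp_neg).swap
  refine (h1.add h2).mono' ?_ (ae_of_all _ fun p => ?_)
  · exact ((hρ.comp (continuous_fst.sub continuous_snd)).aestronglyMeasurable).smul
      (hu.1.comp_snd.mul hv.1.comp_fst)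
  · simp only [norm_smul, norm_mul, Pi.add_apply, ContinuousLinearMap.mul_apply', Function.comp_apply,
      Prod.fst_swap, Prod.snd_swap, neg_sub]
    nlinarith [norm_nonneg (ρ (p.1 - p.2)), mul_nonneg (norm_nonneg (ρ (p.1 - p.2)))
      (sq_nonneg (‖u p.2‖ - ‖v p.1‖)), mul_nonneg (norm_nonneg (ρ (p.1 - p.2)))
      (sq_nonneg (‖u p.2‖ + ‖v p.1‖))]

theorem integral_kernel_swap {ρ : Space d → ℝ} (hρ : Continuous ρ) (hc : HasCompactSupport ρ)
    {u v : Space d → ℂ} (hu : MemLp u 2) (hv : MemLp v 2) :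
    ∫ x, v x * ∫ z, ρ (x - z) • u z = ∫ z, u z * ∫ x, ρ (x - z) • v x := by
  have := integral_integral_swap (f := fun x z => ρ (x - z) • (u z * v x))
    (integrable_kernel_mul_mul hρ hc hu hv)
  simp only [← integral_const_mul]
  simpa only [mul_smul_comm, mul_comm (v _) (u _)] using this

theorem integral_smul_integral_translate {ρ : Space d → ℝ} (hρ : Continuous ρ)
    (hc : HasCompactSupport ρ) {u v : Space d → ℂ} (hu : MemLp u 2) (hv : MemLp v 2) :
    ∫ y, ρ y • ∫ x, u (x - y) * v x = ∫ x, v x * ∫ z, ρ (x - z) • u z := by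
  have hi := integrable_kernel_mul_mul hρ hc hu hv
  have e1 : ∀ x, ∫ z, ρ (x - z) • u z = ∫ y, ρ y • u (x - y) := fun x => by
    simpa using (integral_sub_left_eq_self (fun z => ρ (x - z) • u z) volume x).symm
  have hi' : Integrable (fun p : Space d × Space d => ρ p.2 • (u (p.1 - p.2) * v p.1))
      (volume.prod volume) := by
    have hmp : MeasurePreserving (fun p : Space d × Space d => (p.1, p.1 - p.2))
        (volume.prod volume) (volume.prod volume) :=
      MeasurePreserving.skew_product (g := fun x y : Space d => x - y) (MeasurePreserving.id _)
        (by fun_prop) (ae_of_all _ fun x => (Measure.measurePreserving_sub_left volume x).map_eq)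
    simpa [Function.comp_def] using hmp.integrable_comp_of_integrable hi
  simp_rw [e1, ← integral_const_mul, ← integral_smul]
  rw [← integral_integral_swap (f := fun x y => ρ y • (u (x - y) * v x)) hi']
  refine integral_congr_ae (ae_of_all _ fun x => integral_congr_ae (ae_of_all _ fun y => ?_))
  simp only [Complex.real_smul]; ring

/-- Integration by parts for weak partial derivatives in `L²`. -/
theorem HasWeakPartial.integral_mul_add_eq_zero {i : Fin d} {u v Du Dv : Space d → ℂ}
    (hu : HasWeakPartial i u Du) (hv : HasWeakPartial i v Dv) (u2 : MemLp u 2) (v2 : MemLp v 2)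
    (Du2 : MemLp Du 2) (Dv2 : MemLp Dv 2) :
    (∫ x, u x * Dv x) + ∫ x, Du x * v x = 0 := by
  have c1 := continuous_integral_translate_mul u2 Dv2
  have c2 := continuous_integral_translate_mul Du2 v2
  -- The identity is first proved with `u` and `Du` translated by `y`. Averaged against `ρ(y)`, both
  -- derivatives can be moved onto the smooth kernel `ρ(x - z)`, with opposite signs. Continuity in
  -- `y` then allows `y = 0`.
  have hz : ∀ᵐ y : Space d, (∫ x, u (x - y) * Dv x) + ∫ x, Du (x - y) * v x = 0 := by
    refine ae_eq_zero_of_integral_contDiff_smul_eq_zero (c1.add c2).locallyIntegrable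
      fun ρ hρ hc => ?_
    have hρc := hρ.continuous
    have hpc : Continuous (partialDeriv i ρ) := (contDiff_partialDeriv hρ).continuous
    have hpk := hasCompactSupport_partialDeriv (i := i) hc
    simp only [smul_add]
    have i1 : Integrable fun y => ρ y • ∫ x, u (x - y) * Dv x :=
      (hρc.smul c1).integrable_of_hasCompactSupport hc.smul_right
    have i2 : Integrable fun y => ρ y • ∫ x, Du (x - y) * v x :=
      (hρc.smul c2).integrable_of_hasCompactSupport hc.smul_right
    rw [integral_add i1 i2,
      integral_smul_integral_translate hρc hc u2 Dv2, integral_kernel_swap hρc hc u2 Dv2,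
      integral_smul_integral_translate hρc hc Du2 v2]
    have e1 : ∀ z, ∫ x, ρ (x - z) • Dv x = -∫ x, partialDeriv i ρ (x - z) • v x := by
      intro z
      have := hv (fun x => ρ (x - z)) (hρ.comp (contDiff_id.sub contDiff_const))
        (hc.comp_homeomorph (Homeomorph.subRight z))
      rw [← neg_eq_iff_eq_neg, ← this]
      simp only [partialDeriv_comp_sub_right hρ]
    have e2 : ∀ x, ∫ z, ρ (x - z) • Du z = ∫ z, partialDeriv i ρ (x - z) • u z := by
      intro x
      have := hu (fun z => ρ (x - z)) (hρ.comp (contDiff_const.sub contDiff_id))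
        (hc.comp_homeomorph (Homeomorph.subLeft x))
      simp only [partialDeriv_comp_sub_left hρ, neg_smul, integral_neg, neg_inj] at this
      exact this.symm
    simp_rw [e1, e2, mul_neg, integral_neg]
    rw [integral_kernel_swap hpc hpk u2 v2, neg_add_cancel]
  have := (Continuous.ae_eq_iff_eq volume (c1.add c2) continuous_const).1 hz
  simpa using congrFun this 0

/-- The integrated form of `∂ᵢ|φ|² = 2 Re(φ̄ ∂ᵢφ)`, tested against `∂ᵢη`. -/
theorem HasWeakPartial.integral_normSq_mul {i : Fin d} {u g : Space d → ℂ} {η : Space d → ℝ}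
    (h : HasWeakPartial i u g) (hu : MemLp u 2) (hg : MemLp g 2)
    (hη : ContDiff ℝ ∞ η) {C : ℝ} (h1 : ∀ x, |partialDeriv i η x| ≤ C)
    (h2 : ∀ x, |partialDeriv i (partialDeriv i η) x| ≤ C) :
    ∫ x, partialDeriv i (partialDeriv i η) x * ‖u x‖ ^ 2
      = -2 * ∫ x, partialDeriv i η x * (starRingEnd ℂ (u x) * g x).re := by
  have hk := contDiff_partialDeriv (i := i) hη
  have hk' := contDiff_partialDeriv (i := i) hk
  have hL : ∀ {f : Space d → ℂ} {k : Space d → ℝ}, ContDiff ℝ ∞ k → (∀ x, |k x| ≤ C) → MemLp f 2 →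
      MemLp (fun x => k x • f x) 2 := fun {f k} hk hb hf =>
    hf.of_le_mul (c := C) (hk.continuous.aestronglyMeasurable.smul hf.1) (ae_of_all _ fun x => by
      rw [norm_smul]; exact mul_le_mul_of_nonneg_right (hb x) (norm_nonneg _))
  have hu' : MemLp (fun x => starRingEnd ℂ (u x)) 2 := hu.star
  have hg' : MemLp (fun x => starRingEnd ℂ (g x)) 2 := hg.star
  -- Integration by parts is applied to the pair `∂ᵢη · ū` and `u`; the real part of the result is
  -- the claim.
  have p := h.conj.smul (hu'.locallyIntegrable (by simp)) (hg'.locallyIntegrable (by simp)) hk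
  have m1 := hL hk h1 hu'
  have m2 := hL hk h1 hg'
  have m3 := hL hk' h2 hu'
  have key := p.integral_mul_add_eq_zero h m1 hu (m2.add m3) hg
  have i1 := integrable_mul_of_memLp_two m1 hg
  have i2 := integrable_mul_of_memLp_two (m2.add m3) hu
  have i3 := integrable_mul_of_memLp_two m3 hu
  have i4 := integrable_mul_of_memLp_two m2 hu
  have key' := congrArg Complex.re key
  simp only [Complex.add_re, Complex.zero_re] at key'
  have e1 := integral_re i1
  have e2 := integral_re i2
  have e3 := i3.re
  have e4 := i4.re
  have e5 := i1.re
  simp only [RCLike.re_eq_complex_re] at e1 e2 e3 e4 e5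
  simp only [Pi.add_apply] at e2
  rw [← e1, ← e2] at key'
  simp only [add_mul, Complex.add_re] at key'
  rw [integral_add e4 e3] at key'
  have r1 : ∀ x, ((partialDeriv i η x • starRingEnd ℂ (u x)) * g x).re
      = partialDeriv i η x * (starRingEnd ℂ (u x) * g x).re := fun x => by simp; ring
  have r2 : ∀ x, ((partialDeriv i η x • starRingEnd ℂ (g x)) * u x).re
      = partialDeriv i η x * (starRingEnd ℂ (u x) * g x).re := fun x => by simp; ring
  have r3 : ∀ x, ((partialDeriv i (partialDeriv i η) x • starRingEnd ℂ (u x)) * u x).re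
      = partialDeriv i (partialDeriv i η) x * ‖u x‖ ^ 2 := fun x => by
    rw [← Complex.normSq_eq_norm_sq, Complex.normSq_apply]; simp; ring
  simp only [r1, r2, r3] at key'
  linarith

/-! ### Multiplication of `H¹` functions by bounded smooth functions -/

/-- `η` is smooth and bounded by `C`, together with its pure partial derivatives of first and
second order. -/
structure IsBoundedTest (η : Space d → ℝ) (C : ℝ) : Prop where
  contDiff : ContDiff ℝ ∞ η
  bound : ∀ x, |η x| ≤ C
  bound_one : ∀ i x, |partialDeriv i η x| ≤ C
  bound_two : ∀ i x, |partialDeriv i (partialDeriv i η) x| ≤ C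

theorem MemH1.hasWeakGradient {φ : Space d → ℂ} (h : MemH1 φ) :
    HasWeakGradient φ (weakGradient φ) := by
  rw [weakGradient, dif_pos h.2.1]
  exact h.2.1.choose_spec

theorem integrable_bounded_mul {k f : Space d → ℝ} {C : ℝ} (hk : Continuous k)
    (hb : ∀ x, |k x| ≤ C) (hf : Integrable f) : Integrable fun x => k x * f x :=
  hf.bdd_mul hk.aestronglyMeasurable (ae_of_all _ hb)

theorem memLp_bounded_smul {E : Type*} [NormedAddCommGroup E] [NormedSpace ℝ E]
    {k : Space d → ℝ} {f : Space d → E} {C : ℝ} (hk : Continuous k)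
    (hb : ∀ x, |k x| ≤ C) (hf : MemLp f 2) : MemLp (fun x => k x • f x) 2 :=
  hf.of_le_mul (c := C) (hk.aestronglyMeasurable.smul hf.1) (ae_of_all _ fun x => by
    rw [norm_smul]; exact mul_le_mul_of_nonneg_right (hb x) (norm_nonneg _))

theorem memLp_euclidean_apply {G : Space d → EuclideanSpace ℂ (Fin d)} (hG : MemLp G 2)
    (i : Fin d) : MemLp (fun x => G x i) 2 :=
  (EuclideanSpace.proj (𝕜 := ℂ) i).comp_memLp' hG

/-- The Leibniz rule for the gradient of `k • φ`. -/
def smulGradient (k : Space d → ℝ) (φ : Space d → ℂ) (G : Space d → EuclideanSpace ℂ (Fin d)) :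
    Space d → EuclideanSpace ℂ (Fin d) :=
  fun x => k x • G x + ∑ i, (partialDeriv i k x • φ x) • EuclideanSpace.single i (1 : ℂ)

theorem smulGradient_apply (k : Space d → ℝ) (φ : Space d → ℂ)
    (G : Space d → EuclideanSpace ℂ (Fin d)) (x : Space d) (i : Fin d) :
    smulGradient k φ G x i = k x • G x i + partialDeriv i k x • φ x := by
  simp [smulGradient, Finset.sum_apply, Pi.single_apply]

theorem norm_sq_smulGradient (k : Space d → ℝ) (φ : Space d → ℂ)
    (G : Space d → EuclideanSpace ℂ (Fin d)) (x : Space d) :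
    ‖smulGradient k φ G x‖ ^ 2 = k x ^ 2 * ‖G x‖ ^ 2
      + 2 * k x * ∑ i, partialDeriv i k x * (starRingEnd ℂ (φ x) * G x i).re
      + (∑ i, partialDeriv i k x ^ 2) * ‖φ x‖ ^ 2 := by
  rw [EuclideanSpace.norm_sq_eq, EuclideanSpace.norm_sq_eq, Finset.mul_sum, Finset.mul_sum,
    Finset.sum_mul, ← Finset.sum_add_distrib, ← Finset.sum_add_distrib]
  refine Finset.sum_congr rfl fun i _ => ?_
  rw [smulGradient_apply]
  simp only [← Complex.normSq_eq_norm_sq, Complex.normSq_apply]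
  simp
  ring

theorem MemH1.smul {φ : Space d → ℂ} (h : MemH1 φ) {k : Space d → ℝ} {C : ℝ}
    (hk : ContDiff ℝ ∞ k) (hb : ∀ x, |k x| ≤ C) (hb1 : ∀ i x, |partialDeriv i k x| ≤ C) :
    MemH1 (fun x => k x • φ x) ∧
      weakGradient (fun x => k x • φ x) =ᵐ[volume] smulGradient k φ (weakGradient φ) := by
  have hw := h.hasWeakGradient
  have hφ := h.1
  have hG := h.2.2
  have m1 : MemLp (fun x => k x • φ x) 2 := memLp_bounded_smul hk.continuous hb hφ
  have m2 : MemLp (smulGradient k φ (weakGradient φ)) 2 := by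
    refine (memLp_bounded_smul hk.continuous hb hG).add (memLp_finsetSum _ fun i _ => ?_)
    have := memLp_bounded_smul (contDiff_partialDeriv (i := i) hk).continuous (hb1 i) hφ
    exact ((ContinuousLinearMap.id ℂ ℂ).smulRight
      (EuclideanSpace.single i (1 : ℂ))).comp_memLp' this
  have hwg : HasWeakGradient (fun x => k x • φ x) (smulGradient k φ (weakGradient φ)) := by
    refine ⟨m1.locallyIntegrable (by simp), m2.locallyIntegrable (by simp), fun η hη hc i => ?_⟩
    have hp : HasWeakPartial i φ (fun x => weakGradient φ x i) := fun η hη hc => hw.2.2 η hη hc i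
    simp only [smulGradient_apply]
    exact hp.smul hw.1 ((memLp_euclidean_apply hG i).locallyIntegrable (by simp)) hk η hη hc
  have he := hwg.weakGradient_ae_eq
  exact ⟨⟨m1, ⟨_, hwg⟩, m2.ae_eq he.symm⟩, he⟩

/-! ### First variation and the subsolution inequality -/

theorem partialDeriv_const_mul_one_add {η : Space d → ℝ} (hη : ContDiff ℝ ∞ η) (i : Fin d)
    (c s : ℝ) (x : Space d) :
    partialDeriv i (fun y => c * (1 + s * η y)) x = c * (s * partialDeriv i η x) := by
  have h := (((hη.differentiable (by simp)) x).hasFDerivAt.const_mul s).const_add 1 |>.const_mul c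
  simp [partialDeriv, h.fderiv]

theorem integral_quadratic {f₀ f₁ f₂ : Space d → ℝ} (h₀ : Integrable f₀) (h₁ : Integrable f₁)
    (h₂ : Integrable f₂) (s : ℝ) :
    Integrable (fun x => f₀ x + s * f₁ x + s ^ 2 * f₂ x) ∧
    ∫ x, (f₀ x + s * f₁ x + s ^ 2 * f₂ x)
      = (∫ x, f₀ x) + s * (∫ x, f₁ x) + s ^ 2 * ∫ x, f₂ x := by
  have h₁' := h₁.const_mul s
  have h₂' := h₂.const_mul (s ^ 2)
  have h₀₁ : Integrable fun x => f₀ x + s * f₁ x := h₀.add h₁'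
  exact ⟨h₀₁.add h₂', by
    rw [integral_add h₀₁ h₂', integral_add h₀ h₁', integral_const_mul, integral_const_mul]⟩

/-- The derivative of the energy of the normalized perturbation vanishes at the minimum. -/
theorem first_variation {A₀ A₁ A₂ N₁ N₂ B₀ B₁ B₂ B₃ B₄ : ℝ}
    (h : ∀ s : ℝ, 0 < 1 + s * N₁ + s ^ 2 * N₂ →
      A₀ + B₀ ≤ (A₀ + s * A₁ + s ^ 2 * A₂) / (1 + s * N₁ + s ^ 2 * N₂)
        + (B₀ + s * B₁ + s ^ 2 * (B₂ + s * B₃ + s ^ 2 * B₄)) / (1 + s * N₁ + s ^ 2 * N₂) ^ 2) :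
    A₁ + B₁ = (A₀ + 2 * B₀) * N₁ := by
  have hs : HasDerivAt (fun s : ℝ => s) 1 0 := hasDerivAt_id 0
  have hq : ∀ a b c : ℝ, HasDerivAt (fun s : ℝ => a + s * b + s ^ 2 * c) b 0 := fun a b c => by
    convert! ((hs.mul_const b).const_add a).add ((hs.pow 2).mul_const c) using 1
    simp
  have hB : HasDerivAt (fun s : ℝ => B₀ + s * B₁ + s ^ 2 * (B₂ + s * B₃ + s ^ 2 * B₄)) B₁ 0 := by
    convert! ((hs.mul_const B₁).const_add B₀).add ((hs.pow 2).mul (hq B₂ B₃ B₄)) using 1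
    simp
  have hN := hq 1 N₁ N₂
  have hA := hq A₀ A₁ A₂
  have hd := (hA.div hN (by simp)).add (hB.div (hN.pow 2) (by simp))
  have hmin : IsLocalMin (fun s : ℝ => (A₀ + s * A₁ + s ^ 2 * A₂) / (1 + s * N₁ + s ^ 2 * N₂)
        + (B₀ + s * B₁ + s ^ 2 * (B₂ + s * B₃ + s ^ 2 * B₄))
          / (1 + s * N₁ + s ^ 2 * N₂) ^ 2) 0 := by
    have hev : ∀ᶠ s : ℝ in 𝓝 0, 0 < 1 + s * N₁ + s ^ 2 * N₂ :=
      hN.continuousAt.eventually (lt_mem_nhds (by norm_num))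
    filter_upwards [hev] with s hs
    simpa using h s hs
  have h0 := hmin.hasDerivAt_eq_zero hd
  simp at h0
  linarith

/-- The Euler–Lagrange equation of a ground state, tested against `η φ`. -/
theorem IsGroundState.euler_lagrange {V : Space d → ℝ} {β : ℝ} {φ : Space d → ℂ}
    (hφ : IsGroundState V β φ) {η : Space d → ℝ} {C : ℝ} (hη : IsBoundedTest η C) :
    (∫ x, (η x * ‖weakGradient φ x‖ ^ 2
        + (∑ i, partialDeriv i η x * (starRingEnd ℂ (φ x) * weakGradient φ x i).re)
        + 2 * (η x * (V x * ‖φ x‖ ^ 2))))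
      + ∫ x, 4 * (η x * (β / 2 * ‖φ x‖ ^ 4))
    = ((∫ x, (1 / 2 * ‖weakGradient φ x‖ ^ 2 + V x * ‖φ x‖ ^ 2))
        + 2 * ∫ x, β / 2 * ‖φ x‖ ^ 4) * ∫ x, 2 * (η x * ‖φ x‖ ^ 2) := by
  obtain ⟨⟨hH, hV, hβ, h1⟩, hmin⟩ := hφ
  set G := weakGradient φ with hGdef
  have hG : MemLp G 2 := hH.2.2
  have c0 := hη.contDiff.continuous
  have ci : ∀ i, Continuous (partialDeriv i η) := fun i =>
    (contDiff_partialDeriv hη.contDiff).continuous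
  have iw : Integrable fun x => ‖φ x‖ ^ 2 := hH.1.integrable_norm_pow (by simp)
  have iG : Integrable fun x => ‖G x‖ ^ 2 := hG.integrable_norm_pow (by simp)
  have mul : ∀ {f : Space d → ℝ}, Integrable f → Integrable fun x => η x * f x :=
    integrable_bounded_mul c0 hη.bound
  have iX : Integrable fun x =>
      ∑ i, partialDeriv i η x * (starRingEnd ℂ (φ x) * G x i).re :=
    integrable_finsetSum _ fun i _ => integrable_bounded_mul (ci i) (hη.bound_one i)
      (integrable_mul_of_memLp_two hH.1.star (memLp_euclidean_apply hG i)).re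
  have iY : Integrable fun x => (∑ i, partialDeriv i η x ^ 2) * ‖φ x‖ ^ 2 := by
    refine integrable_bounded_mul (C := ∑ _i : Fin d, C ^ 2) (by fun_prop) (fun x => ?_) iw
    rw [abs_of_nonneg (Finset.sum_nonneg fun i _ => sq_nonneg _)]
    exact Finset.sum_le_sum fun i _ => sq_le_sq' (abs_le.1 (hη.bound_one i x)).1
      (abs_le.1 (hη.bound_one i x)).2
  -- The coefficients come from expanding `(1 + sη)²` and `(1 + sη)⁴`. The quartic polynomial is
  -- nested as a quadratic whose last coefficient is again quadratic, so `integral_quadratic`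
  -- applies twice.
  refine first_variation
    (A₂ := ∫ x, (1 / 2 * (η x * (η x * ‖G x‖ ^ 2)
      + 2 * (η x * ∑ i, partialDeriv i η x * (starRingEnd ℂ (φ x) * G x i).re)
      + (∑ i, partialDeriv i η x ^ 2) * ‖φ x‖ ^ 2) + η x * (η x * (V x * ‖φ x‖ ^ 2))))
    (N₂ := ∫ x, η x * (η x * ‖φ x‖ ^ 2))
    (B₂ := ∫ x, 6 * (η x * (η x * (β / 2 * ‖φ x‖ ^ 4))))
    (B₃ := ∫ x, 4 * (η x * (η x * (η x * (β / 2 * ‖φ x‖ ^ 4)))))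
    (B₄ := ∫ x, η x * (η x * (η x * (η x * (β / 2 * ‖φ x‖ ^ 4))))) fun s hN => ?_
  set N := 1 + s * (∫ x, 2 * (η x * ‖φ x‖ ^ 2)) + s ^ 2 * ∫ x, η x * (η x * ‖φ x‖ ^ 2) with hNdef
  obtain ⟨-, eN⟩ := integral_quadratic iw ((mul iw).const_mul 2) (mul (mul iw)) s
  obtain ⟨iA, eA⟩ := integral_quadratic ((iG.const_mul (1 / 2)).add hV)
    (((mul iG).add iX).add ((mul hV).const_mul 2))
    ((((mul (mul iG)).add ((mul iX).const_mul 2)).add iY).const_mul (1 / 2) |>.add (mul (mul hV))) s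
  obtain ⟨iB', eB'⟩ := integral_quadratic ((mul (mul hβ)).const_mul 6)
    ((mul (mul (mul hβ))).const_mul 4) (mul (mul (mul (mul hβ)))) s
  obtain ⟨-, eB⟩ := integral_quadratic hβ ((mul hβ).const_mul 4) iB' s
  simp only [Pi.add_apply] at eA
  rw [h1, ← hNdef] at eN
  rw [eB'] at eB
  rw [← eA, ← eB]
  -- Here `N` is the squared norm of `(1 + sη)φ`, so `c` normalizes the competitor: the quadratic
  -- energy is divided by `N`, the quartic one by `N²`.
  obtain ⟨c, hc⟩ : ∃ c : ℝ, c ^ 2 = N⁻¹ := ⟨√N⁻¹, Real.sq_sqrt (inv_nonneg.2 hN.le)⟩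
  set k : Space d → ℝ := fun y => c * (1 + s * η y) with hk
  have hkd : ContDiff ℝ ∞ k := contDiff_const.mul (contDiff_const.add (contDiff_const.mul hη.contDiff))
  have hkp : ∀ i x, partialDeriv i k x = c * (s * partialDeriv i η x) := fun i x =>
    partialDeriv_const_mul_one_add hη.contDiff i c s x
  have hC : 0 ≤ C := (abs_nonneg _).trans (hη.bound 0)
  have hkb : ∀ x, |k x| ≤ |c| * (1 + |s| * C) := fun x => by
    rw [hk, abs_mul]
    gcongr
    calc |1 + s * η x| ≤ |1| + |s * η x| := abs_add_le _ _
      _ ≤ _ := by rw [abs_one, abs_mul]; gcongr; exact hη.bound x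
  have hkb1 : ∀ i x, |partialDeriv i k x| ≤ |c| * (1 + |s| * C) := fun i x => by
    rw [hkp, abs_mul, abs_mul]
    gcongr
    have := mul_le_mul_of_nonneg_left (hη.bound_one i x) (abs_nonneg s)
    linarith
  obtain ⟨kH, kG⟩ := hH.smul hkd hkb hkb1
  have n2 : ∀ x, ‖k x • φ x‖ ^ 2 = k x * (k x * ‖φ x‖ ^ 2) := fun x => by
    rw [norm_smul, mul_pow, Real.norm_eq_abs, sq_abs]; ring
  have n4 : ∀ x, ‖k x • φ x‖ ^ 4 = k x ^ 4 * ‖φ x‖ ^ 4 := fun x => by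
    rw [norm_smul, mul_pow, Real.norm_eq_abs, show |k x| ^ 4 = k x ^ 4 from Even.pow_abs (by decide) _]
  have mulk : ∀ {f : Space d → ℝ}, Integrable f → Integrable fun x => k x * f x :=
    integrable_bounded_mul hkd.continuous hkb
  have ekV : (fun x => V x * ‖k x • φ x‖ ^ 2) = fun x => k x * (k x * (V x * ‖φ x‖ ^ 2)) := by
    ext x; rw [n2]; ring
  have ekβ : (fun x => β / 2 * ‖k x • φ x‖ ^ 4)
      = fun x => k x * (k x * (k x * (k x * (β / 2 * ‖φ x‖ ^ 4)))) := by
    ext x; rw [n4]; ring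
  have hkV : Integrable fun x => V x * ‖k x • φ x‖ ^ 2 := by rw [ekV]; exact mulk (mulk hV)
  have hkmem : (fun x => k x • φ x) ∈ unitSphere V β := by
    refine ⟨kH, hkV, by rw [ekβ]; exact mulk (mulk (mulk (mulk hβ))), ?_⟩
    have : ∀ x, ‖k x • φ x‖ ^ 2
        = N⁻¹ * (‖φ x‖ ^ 2 + s * (2 * (η x * ‖φ x‖ ^ 2)) + s ^ 2 * (η x * (η x * ‖φ x‖ ^ 2))) :=
      fun x => by rw [n2, ← hc, hk]; ring
    simp_rw [this]
    rw [integral_const_mul, eN, inv_mul_cancel₀ hN.ne']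
  have hle := hmin _ hkmem
  have kG2 : Integrable fun x => 1 / 2 * ‖weakGradient (fun x => k x • φ x) x‖ ^ 2 :=
    (kH.2.2.integrable_norm_pow (by simp)).const_mul _
  rw [energy, energy, ← integral_add (iG.const_mul (1 / 2)) hV, ← integral_add kG2 hkV] at hle
  refine hle.trans_eq ?_
  rw [div_eq_inv_mul _ N, div_eq_inv_mul _ (N ^ 2), ← inv_pow, ← hc,
    ← integral_const_mul, ← integral_const_mul]
  congr 1
  · refine integral_congr_ae ?_
    filter_upwards [kG] with x hx
    rw [hx, norm_sq_smulGradient, n2]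
    simp only [hkp, mul_pow, mul_assoc c, mul_assoc s, ← Finset.mul_sum]
    rw [hk]
    ring
  · refine integral_congr_ae (ae_of_all _ fun x => ?_)
    beta_reduce
    rw [n4]
    simp only [hk]
    ring

/-- The density `|φ|²` of a ground state is a weak subsolution of `Δw = 4(V - μ)w`. -/
theorem IsGroundState.exists_subsolution {V : Space d → ℝ} {β : ℝ} {φ : Space d → ℂ}
    (hV : ∀ᵐ x, 0 ≤ V x) (hβ : 0 ≤ β) (hφ : IsGroundState V β φ) :
    ∃ μ : ℝ, 0 ≤ μ ∧ ∀ (η : Space d → ℝ) (C : ℝ), IsBoundedTest η C → (∀ x, 0 ≤ η x) →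
      4 * (∫ x, η x * (V x * ‖φ x‖ ^ 2)) - 4 * μ * ∫ x, η x * ‖φ x‖ ^ 2
        ≤ ∫ x, (∑ i, partialDeriv i (partialDeriv i η) x) * ‖φ x‖ ^ 2 := by
  -- The chemical potential: the energy with the interaction counted twice, because that term is
  -- homogeneous of degree four.
  refine ⟨(∫ x, (1 / 2 * ‖weakGradient φ x‖ ^ 2 + V x * ‖φ x‖ ^ 2))
        + 2 * ∫ x, β / 2 * ‖φ x‖ ^ 4, ?_, fun η C hη h0 => ?_⟩
  · refine add_nonneg (integral_nonneg_of_ae ?_)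
      (mul_nonneg (by norm_num) (integral_nonneg fun x => by positivity))
    filter_upwards [hV] with x hx
    have := norm_nonneg (φ x)
    simp only [Pi.zero_apply]
    positivity
  have h := hφ.euler_lagrange hη
  obtain ⟨⟨hH, iV, iβ, -⟩, -⟩ := hφ
  set μ := (∫ x, (1 / 2 * ‖weakGradient φ x‖ ^ 2 + V x * ‖φ x‖ ^ 2)) + 2 * ∫ x, β / 2 * ‖φ x‖ ^ 4
  set G := weakGradient φ with hGdef
  have hG : MemLp G 2 := hH.2.2
  have c0 := hη.contDiff.continuous
  have ci : ∀ i, Continuous (partialDeriv i η) := fun i =>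
    (contDiff_partialDeriv hη.contDiff).continuous
  have iw : Integrable fun x => ‖φ x‖ ^ 2 := hH.1.integrable_norm_pow (by simp)
  have iG : Integrable fun x => ‖G x‖ ^ 2 := hG.integrable_norm_pow (by simp)
  have mul : ∀ {f : Space d → ℝ}, Integrable f → Integrable fun x => η x * f x :=
    integrable_bounded_mul c0 hη.bound
  have iXi : ∀ i, Integrable fun x => partialDeriv i η x * (starRingEnd ℂ (φ x) * G x i).re :=
    fun i => integrable_bounded_mul (ci i) (hη.bound_one i)
      (integrable_mul_of_memLp_two hH.1.star (memLp_euclidean_apply hG i)).re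
  have iX := integrable_finsetSum Finset.univ fun i _ => iXi i
  have eX : ∫ x, (∑ i, partialDeriv i (partialDeriv i η) x) * ‖φ x‖ ^ 2
      = -2 * ∫ x, ∑ i, partialDeriv i η x * (starRingEnd ℂ (φ x) * G x i).re := by
    simp_rw [Finset.sum_mul]
    rw [integral_finsetSum _ fun i _ => iXi i, Finset.mul_sum, integral_finsetSum _ fun i _ =>
      integrable_bounded_mul (contDiff_partialDeriv (contDiff_partialDeriv hη.contDiff)).continuous
        (hη.bound_two i) iw]
    refine Finset.sum_congr rfl fun i _ => ?_
    have hp : HasWeakPartial i φ (fun x => G x i) := fun η hη hc =>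
      hH.hasWeakGradient.2.2 η hη hc i
    exact hp.integral_normSq_mul hH.1 (memLp_euclidean_apply hG i) hη.contDiff
      (hη.bound_one i) (hη.bound_two i)
  have i2 : Integrable fun x => η x * ‖G x‖ ^ 2
      + ∑ i, partialDeriv i η x * (starRingEnd ℂ (φ x) * G x i).re := (mul iG).add iX
  rw [integral_add i2 ((mul iV).const_mul 2), integral_add (mul iG) iX, integral_const_mul,
    integral_const_mul, integral_const_mul] at h
  have p1 : 0 ≤ ∫ x, η x * ‖G x‖ ^ 2 := integral_nonneg fun x => mul_nonneg (h0 x) (by positivity)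
  have p2 : 0 ≤ ∫ x, η x * (β / 2 * ‖φ x‖ ^ 4) :=
    integral_nonneg fun x => mul_nonneg (h0 x) (by positivity)
  rw [eX]
  linarith

/-! ### Bounded exponential weights and exponential moments -/

theorem abs_apply_le_norm (x : Space d) (i : Fin d) : |x i| ≤ ‖x‖ := PiLp.norm_apply_le x i

theorem partialDeriv_comp_inner {k k' : ℝ → ℝ} (hk : ∀ s, HasDerivAt k (k' s) s) (a : Space d)
    (i : Fin d) :
    partialDeriv i (fun x => k (inner ℝ a x)) = fun x => a i * k' (inner ℝ a x) := by
  ext x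
  have h := (hk (inner ℝ a x)).comp_hasFDerivAt x (innerSL ℝ a).hasFDerivAt
  simp only [Function.comp_def] at h
  rw [partialDeriv, h.fderiv]
  simp [EuclideanSpace.inner_single_right, mul_comm]

/-- A bounded approximation of `exp s`, which increases to `exp s` as `δ` decreases to zero. -/
def cutExp (δ s : ℝ) : ℝ := (Real.exp (-s) + δ * Real.exp s)⁻¹

/-- The logarithmic derivative of `cutExp δ`. -/
def cutExpSlope (δ s : ℝ) : ℝ := (Real.exp (-s) - δ * Real.exp s) * cutExp δ s

section CutExp

variable {δ : ℝ}

theorem cutExp_den_pos (hδ : 0 < δ) (s : ℝ) : 0 < Real.exp (-s) + δ * Real.exp s := by positivity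

theorem cutExp_pos (hδ : 0 < δ) (s : ℝ) : 0 < cutExp δ s := inv_pos.2 (cutExp_den_pos hδ s)

theorem cutExp_le_exp (hδ : 0 < δ) (s : ℝ) : cutExp δ s ≤ Real.exp s := by
  rw [cutExp, ← inv_inv (Real.exp s), ← Real.exp_neg]
  exact inv_anti₀ (Real.exp_pos _) (by simpa using by positivity)

theorem cutExp_le (hδ : 0 < δ) (s : ℝ) : cutExp δ s ≤ 1 + δ⁻¹ := by
  rcases le_total s 0 with hs | hs
  · refine (cutExp_le_exp hδ s).trans ((Real.exp_le_one_iff.2 hs).trans ?_)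
    simpa using by positivity
  · have : cutExp δ s ≤ δ⁻¹ := by
      refine inv_anti₀ hδ ?_
      nlinarith [Real.exp_pos (-s), Real.one_le_exp hs]
    linarith

theorem abs_cutExpSlope_le (hδ : 0 < δ) (s : ℝ) : |cutExpSlope δ s| ≤ 1 := by
  have h := cutExp_den_pos hδ s
  rw [cutExpSlope, cutExp, ← div_eq_mul_inv, abs_div, abs_of_pos h, div_le_one h, abs_le]
  constructor <;> nlinarith [Real.exp_pos (-s), mul_pos hδ (Real.exp_pos s)]

theorem contDiff_cutExp (hδ : 0 < δ) : ContDiff ℝ ∞ (cutExp δ) := by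
  unfold cutExp
  exact ContDiff.inv (by fun_prop) fun s => (cutExp_den_pos hδ s).ne'

theorem hasDerivAt_cutExp (hδ : 0 < δ) (s : ℝ) :
    HasDerivAt (cutExp δ) (cutExpSlope δ s * cutExp δ s) s := by
  have h : HasDerivAt (fun s => Real.exp (-s) + δ * Real.exp s)
      (-Real.exp (-s) + δ * Real.exp s) s := by
    convert! (hasDerivAt_neg s).exp.add ((Real.hasDerivAt_exp s).const_mul δ) using 1
    ring
  have hp := (cutExp_den_pos hδ s).ne'
  convert! h.inv hp using 1
  rw [cutExpSlope, cutExp]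
  field_simp
  ring

/-- The slope `σ` solves `σ' = σ² - 1`, so the second derivative carries the factor `σ' + σ² = 2σ² -
1`, which is at most `1` because `|σ| ≤ 1`. -/
theorem hasDerivAt_cutExpSlope_mul (hδ : 0 < δ) (s : ℝ) :
    HasDerivAt (fun s => cutExpSlope δ s * cutExp δ s)
      ((2 * cutExpSlope δ s ^ 2 - 1) * cutExp δ s) s := by
  have h : HasDerivAt (fun s => Real.exp (-s) - δ * Real.exp s)
      (-Real.exp (-s) - δ * Real.exp s) s := by
    convert! (hasDerivAt_neg s).exp.sub ((Real.hasDerivAt_exp s).const_mul δ) using 1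
    ring
  have hp := (cutExp_den_pos hδ s).ne'
  have hc := hasDerivAt_cutExp hδ s
  convert! (h.mul hc).mul hc using 1
  simp only [Pi.mul_apply, cutExpSlope, cutExp]
  field_simp
  ring

end CutExp

section Inner

variable {δ : ℝ} (a : Space d)

theorem partialDeriv_cutExp_inner (hδ : 0 < δ) (i : Fin d) :
    partialDeriv i (fun x => cutExp δ (inner ℝ a x))
      = fun x => a i * (cutExpSlope δ (inner ℝ a x) * cutExp δ (inner ℝ a x)) :=
  partialDeriv_comp_inner (hasDerivAt_cutExp hδ) a i

theorem partialDeriv_partialDeriv_cutExp_inner (hδ : 0 < δ) (i : Fin d) :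
    partialDeriv i (partialDeriv i (fun x => cutExp δ (inner ℝ a x)))
      = fun x => a i * (a i * ((2 * cutExpSlope δ (inner ℝ a x) ^ 2 - 1)
          * cutExp δ (inner ℝ a x))) := by
  rw [partialDeriv_cutExp_inner a hδ]
  exact partialDeriv_comp_inner (fun s => (hasDerivAt_cutExpSlope_mul hδ s).const_mul (a i)) a i

theorem isBoundedTest_cutExp_inner (hδ : 0 < δ) :
    IsBoundedTest (fun x => cutExp δ (inner ℝ a x)) ((1 + ‖a‖ + ‖a‖ * ‖a‖) * (1 + δ⁻¹)) := by
  have hk : ∀ s, |cutExp δ s| ≤ 1 + δ⁻¹ := fun s => by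
    rw [abs_of_pos (cutExp_pos hδ s)]; exact cutExp_le hδ s
  have ha := norm_nonneg a
  have hD : 0 ≤ 1 + δ⁻¹ := by positivity
  refine ⟨(contDiff_cutExp hδ).comp (contDiff_const.inner ℝ contDiff_id), fun x => ?_,
    fun i x => ?_, fun i x => ?_⟩
  · refine (hk _).trans ?_
    nlinarith [mul_nonneg ha hD, mul_nonneg (mul_nonneg ha ha) hD]
  · rw [partialDeriv_cutExp_inner a hδ, abs_mul, abs_mul]
    calc _ ≤ ‖a‖ * (1 * (1 + δ⁻¹)) := by
          gcongr
          · exact abs_apply_le_norm a i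
          · exact abs_cutExpSlope_le hδ _
          · exact hk _
      _ ≤ _ := by nlinarith [mul_nonneg (mul_nonneg ha ha) hD]
  · have hs : |2 * cutExpSlope δ (inner ℝ a x) ^ 2 - 1| ≤ 1 := by
      have h1 := (sq_le_one_iff_abs_le_one _).2 (abs_cutExpSlope_le hδ (inner ℝ a x))
      rw [abs_le]
      constructor <;> nlinarith [sq_nonneg (cutExpSlope δ (inner ℝ a x))]
    rw [partialDeriv_partialDeriv_cutExp_inner a hδ, abs_mul, abs_mul, abs_mul]
    calc _ ≤ ‖a‖ * (‖a‖ * (1 * (1 + δ⁻¹))) := by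
          gcongr
          · exact abs_apply_le_norm a i
          · exact abs_apply_le_norm a i
          · exact hk _
      _ ≤ _ := by nlinarith [mul_nonneg ha hD]

theorem laplacian_cutExp_inner_le (hδ : 0 < δ) (x : Space d) :
    ∑ i, partialDeriv i (partialDeriv i (fun x => cutExp δ (inner ℝ a x))) x
      ≤ ‖a‖ ^ 2 * cutExp δ (inner ℝ a x) := by
  simp only [partialDeriv_partialDeriv_cutExp_inner a hδ]
  rw [EuclideanSpace.norm_sq_eq, Finset.sum_mul]
  refine Finset.sum_le_sum fun i _ => ?_
  have h1 := (sq_le_one_iff_abs_le_one _).2 (abs_cutExpSlope_le hδ (inner ℝ a x))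
  rw [Real.norm_eq_abs, sq_abs, ← mul_assoc, ← sq]
  refine mul_le_mul_of_nonneg_left ?_ (sq_nonneg _)
  nlinarith [cutExp_pos hδ (inner ℝ a x)]

end Inner

/-- Exponential moments of an integrable weak subsolution of `Δw = 4(V - μ)w`. -/
theorem exists_integral_cutExp_mul_le {V w : Space d → ℝ} {μ : ℝ} (hV : ∀ᵐ x, 0 ≤ V x)
    (hconf : IsConfining V) (hμ : 0 ≤ μ) (hw0 : ∀ x, 0 ≤ w x) (hw : Integrable w)
    (hVw : Integrable fun x => V x * w x)
    (hsub : ∀ (η : Space d → ℝ) (C : ℝ), IsBoundedTest η C → (∀ x, 0 ≤ η x) →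
      4 * (∫ x, η x * (V x * w x)) - 4 * μ * ∫ x, η x * w x
        ≤ ∫ x, (∑ i, partialDeriv i (partialDeriv i η) x) * w x) (a : Space d) :
    ∃ K : ℝ, ∀ δ : ℝ, 0 < δ → ∫ x, cutExp δ (inner ℝ a x) * w x ≤ K := by
  -- The threshold is chosen so that `4(V - μ) - |a|² ≥ 1` for `|x| ≥ R`.
  obtain ⟨R, hR⟩ := hconf (μ + ‖a‖ ^ 2 / 4 + 1 / 4)
  set D := (1 + 4 * μ + ‖a‖ ^ 2) * Real.exp (‖a‖ * |R|) with hD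
  refine ⟨D * ∫ x, w x, fun δ hδ => ?_⟩
  set η : Space d → ℝ := fun x => cutExp δ (inner ℝ a x) with hη
  have hηt := isBoundedTest_cutExp_inner a hδ
  have hη0 : ∀ x, 0 < η x := fun x => cutExp_pos hδ _
  have h := hsub η _ hηt fun x => (hη0 x).le
  have i1 : Integrable fun x => η x * w x :=
    integrable_bounded_mul hηt.contDiff.continuous hηt.bound hw
  have i2 : Integrable fun x => η x * (V x * w x) :=
    integrable_bounded_mul hηt.contDiff.continuous hηt.bound hVw
  have hle : ∫ x, (∑ i, partialDeriv i (partialDeriv i η) x) * w x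
      ≤ ∫ x, ‖a‖ ^ 2 * (η x * w x) := by
    refine integral_mono ?_ (i1.const_mul _) fun x => ?_
    · simp_rw [Finset.sum_mul]
      exact integrable_finsetSum _ fun i _ => integrable_bounded_mul
        (contDiff_partialDeriv (contDiff_partialDeriv hηt.contDiff)).continuous (hηt.bound_two i) hw
    · simpa only [mul_assoc] using
        mul_le_mul_of_nonneg_right (laplacian_cutExp_inner_le a hδ x) (hw0 x)
  rw [integral_const_mul] at hle
  -- Outside the ball the choice of `R` gives the pointwise inequality without `D`. Inside, `η ≤
  -- exp(|a||R|)` independently of `δ`, and `D w` absorbs the negative term. The subsolution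
  -- inequality makes the integral of the first two terms nonpositive.
  have hpt : ∫ x, η x * w x
      ≤ ∫ x, (4 * (η x * (V x * w x)) - (4 * μ + ‖a‖ ^ 2) * (η x * w x) + D * w x) := by
    refine integral_mono_ae i1 (((i2.const_mul _).sub (i1.const_mul _)).add (hw.const_mul _)) ?_
    filter_upwards [hV, hR] with x h0 hx
    have hηw : 0 ≤ η x * w x := mul_nonneg (hη0 x).le (hw0 x)
    have hD0 : 0 ≤ D := by positivity
    rcases le_or_gt R ‖x‖ with hRx | hRx
    · have := hx hRx
      nlinarith [mul_nonneg hD0 (hw0 x), mul_nonneg hηw (sub_nonneg.2 this)]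
    · have h1 : η x ≤ Real.exp (‖a‖ * |R|) := by
        refine (cutExp_le_exp hδ _).trans (Real.exp_le_exp.2 ((real_inner_le_norm a x).trans ?_))
        gcongr
        exact hRx.le.trans (le_abs_self R)
      have h2 : (1 + 4 * μ + ‖a‖ ^ 2) * η x ≤ D :=
        mul_le_mul_of_nonneg_left h1 (by positivity)
      nlinarith [mul_nonneg hηw h0, mul_le_mul_of_nonneg_right h2 (hw0 x)]
  have i3 : Integrable fun x => 4 * (η x * (V x * w x)) - (4 * μ + ‖a‖ ^ 2) * (η x * w x) :=
    (i2.const_mul _).sub (i1.const_mul _)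
  rw [integral_add i3 (hw.const_mul _), integral_sub (i2.const_mul _) (i1.const_mul _),
    integral_const_mul, integral_const_mul, integral_const_mul] at hpt
  linarith

/-! ### Gaussians and the heat kernel -/

/-- An unnormalized Gaussian centred at `x`. -/
def gauss (c b : ℝ) (x y : Space d) : ℝ := Real.exp (c - b * ‖y - x‖ ^ 2)

theorem mul_exp_neg_le_one (u : ℝ) : u * Real.exp (-u) ≤ 1 := by
  rw [Real.exp_neg, ← div_eq_mul_inv, div_le_one (Real.exp_pos u)]
  linarith [Real.add_one_le_exp u]

theorem mul_gauss_le (c b : ℝ) (x y : Space d) :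
    b * ‖y - x‖ ^ 2 * gauss c b x y ≤ Real.exp c := by
  have h := mul_le_mul_of_nonneg_left (mul_exp_neg_le_one (b * ‖y - x‖ ^ 2)) (Real.exp_pos c).le
  rw [gauss, sub_eq_add_neg c, Real.exp_add]
  linarith

theorem gauss_le {c b : ℝ} (hb : 0 ≤ b) (x y : Space d) : gauss c b x y ≤ Real.exp c :=
  Real.exp_le_exp.2 (sub_le_self _ (by positivity))

theorem gauss_pos (c b : ℝ) (x y : Space d) : 0 < gauss c b x y := Real.exp_pos _

theorem contDiff_gauss (c b : ℝ) (x : Space d) : ContDiff ℝ ∞ (gauss c b x) :=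
  (contDiff_const.sub (contDiff_const.mul ((contDiff_id.sub contDiff_const).norm_sq ℝ))).exp

theorem hasFDerivAt_gauss (c b : ℝ) (x y : Space d) :
    HasFDerivAt (gauss c b x) (-(gauss c b x y • b • (2 : ℕ) • innerSL ℝ (y - x))) y := by
  have h := (((hasFDerivAt_id (𝕜 := ℝ) y).sub_const x).norm_sq.const_mul b).const_sub c |>.exp
  convert! h using 1
  ext v
  simp [gauss]

theorem partialDeriv_gauss (c b : ℝ) (x : Space d) (i : Fin d) :
    partialDeriv i (gauss c b x) = fun y => -(2 * b) * (y i - x i) * gauss c b x y := by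
  ext y
  rw [partialDeriv, (hasFDerivAt_gauss c b x y).fderiv]
  simp [EuclideanSpace.inner_single_right]
  ring

theorem partialDeriv_partialDeriv_gauss (c b : ℝ) (x : Space d) (i : Fin d) :
    partialDeriv i (partialDeriv i (gauss c b x))
      = fun y => (-(2 * b) + 4 * b ^ 2 * (y i - x i) ^ 2) * gauss c b x y := by
  ext y
  have h := (((EuclideanSpace.proj (𝕜 := ℝ) i).hasFDerivAt (x := y)).sub_const (x i)).const_mul
    (-(2 * b)) |>.fun_mul (hasFDerivAt_gauss c b x y)
  rw [partialDeriv_gauss, partialDeriv]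
  simp only [PiLp.proj_apply] at h
  rw [h.fderiv]
  simp [EuclideanSpace.inner_single_right]
  ring

theorem laplacian_gauss (c b : ℝ) (x y : Space d) :
    ∑ i, partialDeriv i (partialDeriv i (gauss c b x)) y
      = (-(2 * b) * d + 4 * b ^ 2 * ‖y - x‖ ^ 2) * gauss c b x y := by
  simp only [partialDeriv_partialDeriv_gauss]
  rw [← Finset.sum_mul, Finset.sum_add_distrib, ← Finset.mul_sum, EuclideanSpace.norm_sq_eq]
  simp
  left; ring

theorem isBoundedTest_gauss (c : ℝ) {b : ℝ} (hb : 0 < b) (x : Space d) :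
    IsBoundedTest (gauss c b x) ((6 * b + 1) * Real.exp c) := by
  have hg := gauss_pos c b x
  have hu := mul_gauss_le c b x
  have hle := gauss_le (c := c) hb.le x
  have hc := Real.exp_pos c
  have hi : ∀ i y, b * (y i - x i) ^ 2 * gauss c b x y ≤ Real.exp c := fun i y => by
    refine le_trans ?_ (hu y)
    have : (y i - x i) ^ 2 ≤ ‖y - x‖ ^ 2 :=
      sq_le_sq.2 (by simpa using PiLp.norm_apply_le (y - x) i)
    have := (hg y).le
    gcongr
  refine ⟨contDiff_gauss c b x, fun y => ?_, fun i y => ?_, fun i y => ?_⟩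
  · rw [abs_of_pos (hg y)]
    nlinarith [hle y]
  · have hz : |y i - x i| ≤ (1 + (y i - x i) ^ 2) / 2 := by
      rw [← sq_abs]; nlinarith [sq_nonneg (|y i - x i| - 1)]
    rw [partialDeriv_gauss, abs_mul, abs_mul, abs_of_pos (hg y), abs_neg,
      abs_of_pos (by positivity : 0 < 2 * b)]
    have h1 := mul_le_mul_of_nonneg_left hz (mul_pos hb (hg y)).le
    nlinarith [hi i y, mul_le_mul_of_nonneg_left (hle y) hb.le, mul_pos hb hc]
  · rw [partialDeriv_partialDeriv_gauss, abs_mul, abs_of_pos (hg y)]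
    have h1 : |-(2 * b) + 4 * b ^ 2 * (y i - x i) ^ 2| ≤ 2 * b + 4 * b * (b * (y i - x i) ^ 2) := by
      rw [abs_le]
      constructor <;> nlinarith [mul_nonneg hb.le (mul_nonneg hb.le (sq_nonneg (y i - x i)))]
    have h2 := mul_le_mul_of_nonneg_right h1 (hg y).le
    nlinarith [mul_le_mul_of_nonneg_left (hi i y) hb.le, mul_le_mul_of_nonneg_left (hle y) hb.le]

/-- The heat kernel at time `exp (2 * τ)`, up to a constant factor. -/
def heat (τ : ℝ) (x y : Space d) : ℝ := gauss (-(d * τ)) (Real.exp (-(2 * τ)) / 4) x y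

theorem heat_eq_exp (τ : ℝ) (x y : Space d) :
    heat τ x y = Real.exp (-(d * τ) - Real.exp (-(2 * τ)) / 4 * ‖y - x‖ ^ 2) := rfl

/-- With `t = exp(2τ)` this is the heat equation, since `∂_τ = 2t ∂_t`. The logarithmic time turns
the prefactor `t^(-d/2)` into `exp(-dτ)` and lets `τ` range over all of `ℝ`. -/
theorem hasDerivAt_heat (τ : ℝ) (x y : Space d) :
    HasDerivAt (fun τ => heat τ x y)
      (2 * Real.exp (2 * τ) * ∑ i, partialDeriv i (partialDeriv i (heat τ x)) y) τ := by
  have h1 : HasDerivAt (fun τ : ℝ => Real.exp (-(2 * τ)) / 4 * ‖y - x‖ ^ 2)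
      (Real.exp (-(2 * τ)) * (-2) / 4 * ‖y - x‖ ^ 2) τ := by
    have := ((hasDerivAt_id τ).const_mul 2).neg.exp.div_const 4 |>.mul_const (‖y - x‖ ^ 2)
    simpa using this
  have h2 : HasDerivAt (fun τ : ℝ => -(d * τ)) (-(d : ℝ)) τ := by
    simpa using (hasDerivAt_id τ).const_mul (d : ℝ) |>.fun_neg
  have h3 := (h2.sub h1).exp
  refine h3.congr_deriv ?_
  have hl := laplacian_gauss (-(d * τ)) (Real.exp (-(2 * τ)) / 4) x y
  change ∑ i, partialDeriv i (partialDeriv i (heat τ x)) y = _ at hl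
  rw [hl, gauss]
  have he : Real.exp (2 * τ) * Real.exp (-(2 * τ)) = 1 := by rw [← Real.exp_add]; simp
  simp only [Pi.sub_apply]
  linear_combination (Real.exp (-(d * τ) - Real.exp (-(2 * τ)) / 4 * ‖y - x‖ ^ 2)
    * (d - Real.exp (-(2 * τ)) / 2 * ‖y - x‖ ^ 2)) * he

theorem isBoundedTest_heat (τ : ℝ) (x : Space d) :
    IsBoundedTest (heat τ x)
      ((6 * (Real.exp (-(2 * τ)) / 4) + 1) * Real.exp (-(d * τ))) :=
  isBoundedTest_gauss _ (by positivity) x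

/-- A bound uniform in `y`, used as the dominating constant when differentiating under the integral.
-/
theorem abs_deriv_heat_le (τ : ℝ) (x y : Space d) :
    |2 * Real.exp (2 * τ) * ∑ i, partialDeriv i (partialDeriv i (heat τ x)) y|
      ≤ (d + 2) * Real.exp (-(d * τ)) := by
  have hl := laplacian_gauss (-(d * τ)) (Real.exp (-(2 * τ)) / 4) x y
  change ∑ i, partialDeriv i (partialDeriv i (heat τ x)) y = _ at hl
  have he : Real.exp (2 * τ) * Real.exp (-(2 * τ)) = 1 := by rw [← Real.exp_add]; simp
  have e : 2 * Real.exp (2 * τ) * ∑ i, partialDeriv i (partialDeriv i (heat τ x)) y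
      = -d * heat τ x y + 2 * (Real.exp (-(2 * τ)) / 4 * ‖y - x‖ ^ 2 * heat τ x y) := by
    rw [hl, heat]
    linear_combination (gauss (-(d * τ)) (Real.exp (-(2 * τ)) / 4) x y
      * (-d + Real.exp (-(2 * τ)) / 2 * ‖y - x‖ ^ 2)) * he
  have h1 : Real.exp (-(2 * τ)) / 4 * ‖y - x‖ ^ 2 * heat τ x y ≤ Real.exp (-(d * τ)) :=
    mul_gauss_le _ _ x y
  have h2 : heat τ x y ≤ Real.exp (-(d * τ)) := gauss_le (by positivity) x y
  have h3 : 0 < heat τ x y := gauss_pos _ _ x y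
  have h4 : 0 ≤ Real.exp (-(2 * τ)) / 4 * ‖y - x‖ ^ 2 * heat τ x y := by positivity
  have h5 : (d : ℝ) * heat τ x y ≤ d * Real.exp (-(d * τ)) :=
    mul_le_mul_of_nonneg_left h2 (Nat.cast_nonneg d)
  have h6 : 0 ≤ (d : ℝ) * heat τ x y := by positivity
  rw [e, abs_le]
  constructor <;> nlinarith [Real.exp_pos (-(d * τ))]

/-! ### Almost everywhere bounds from heat flow monotonicity -/

section Subsolution

variable {w : Space d → ℝ} {μ : ℝ}

theorem integrable_heat_mul (hw : Integrable w) (τ : ℝ) (x : Space d) :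
    Integrable fun y => heat τ x y * w y :=
  integrable_bounded_mul (isBoundedTest_heat τ x).contDiff.continuous
    (isBoundedTest_heat τ x).bound hw

theorem hasDerivAt_integral_heat_mul (hw : Integrable w) (x : Space d) (τ₀ : ℝ) :
    HasDerivAt (fun τ => ∫ y, heat τ x y * w y)
      (2 * Real.exp (2 * τ₀) * ∫ y, (∑ i, partialDeriv i (partialDeriv i (heat τ₀ x)) y) * w y)
      τ₀ := by
  have hc : ∀ τ, Continuous fun y => ∑ i, partialDeriv i (partialDeriv i (heat τ x)) y :=
    fun τ => continuous_finsetSum _ fun i _ => (contDiff_partialDeriv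
      (contDiff_partialDeriv (isBoundedTest_heat τ x).contDiff)).continuous
  have h := (hasDerivAt_integral_of_dominated_loc_of_deriv_le (μ := volume) (x₀ := τ₀)
    (s := Metric.ball τ₀ 1) (F := fun τ y => heat τ x y * w y)
    (F' := fun τ y => 2 * Real.exp (2 * τ)
      * (∑ i, partialDeriv i (partialDeriv i (heat τ x)) y) * w y)
    (bound := fun y => (d + 2) * Real.exp (d * (|τ₀| + 1)) * ‖w y‖)
    (Metric.ball_mem_nhds _ one_pos)
    (Eventually.of_forall fun τ => (integrable_heat_mul hw τ x).1) (integrable_heat_mul hw τ₀ x)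
    ((((hc τ₀).const_mul _).aestronglyMeasurable).mul hw.1)
    (ae_of_all _ fun y τ hτ => ?_) (hw.norm.const_mul _)
    (ae_of_all _ fun y τ _ => (hasDerivAt_heat τ x y).mul_const (w y))).2
  · simpa only [mul_assoc, integral_const_mul] using h
  · rw [norm_mul, Real.norm_eq_abs]
    refine mul_le_mul_of_nonneg_right ((abs_deriv_heat_le τ x y).trans ?_) (norm_nonneg _)
    gcongr
    rw [← mul_neg]
    gcongr
    rw [Metric.mem_ball, Real.dist_eq, abs_lt] at hτ
    linarith [neg_abs_le τ₀]

/-- The subsolution inequality makes `exp(μt)` times the heat average nondecreasing in `t =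
exp(2τ)`; times `t ≤ 1` are compared with `t = 1`. -/
theorem integral_heat_mul_le (hμ : 0 ≤ μ) (hw0 : ∀ x, 0 ≤ w x) (hw : Integrable w)
    (hsub : ∀ (η : Space d → ℝ) (C : ℝ), IsBoundedTest η C → (∀ x, 0 ≤ η x) →
      -(μ * ∫ x, η x * w x) ≤ ∫ x, (∑ i, partialDeriv i (partialDeriv i η) x) * w x)
    (x : Space d) {τ : ℝ} (hτ : τ ≤ 0) :
    ∫ y, heat τ x y * w y ≤ Real.exp μ * ∫ y, heat 0 x y * w y := by
  have hE : ∀ τ : ℝ, HasDerivAt (fun τ => Real.exp (μ * Real.exp (2 * τ)))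
      (Real.exp (μ * Real.exp (2 * τ)) * (μ * (Real.exp (2 * τ) * 2))) τ := fun τ => by
    simpa using (((hasDerivAt_id τ).const_mul 2).exp.const_mul μ).exp
  have hP := fun τ => (hE τ).mul (hasDerivAt_integral_heat_mul hw x τ)
  have hmono := monotone_of_hasDerivAt_nonneg hP fun τ => by
    have h := hsub _ _ (isBoundedTest_heat τ x) fun y => (gauss_pos _ _ x y).le
    have h1 := mul_le_mul_of_nonneg_left h (by positivity :
      0 ≤ Real.exp (μ * Real.exp (2 * τ)) * (2 * Real.exp (2 * τ)))
    simp only [Pi.zero_apply]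
    linarith
  have h := hmono hτ
  simp only [Pi.mul_apply, mul_zero, Real.exp_zero, mul_one] at h
  refine le_trans (le_mul_of_one_le_left ?_ (Real.one_le_exp (by positivity))) h
  exact integral_nonneg fun y => mul_nonneg (gauss_pos _ _ x y).le (hw0 y)

/-- A weak subsolution of `Δw = -μw` is bounded by a constant times its Gaussian average. -/
theorem exists_ae_le_integral_heat_mul (hμ : 0 ≤ μ) (hw0 : ∀ x, 0 ≤ w x) (hw : Integrable w)
    (hsub : ∀ (η : Space d → ℝ) (C : ℝ), IsBoundedTest η C → (∀ x, 0 ≤ η x) →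
      -(μ * ∫ x, η x * w x) ≤ ∫ x, (∑ i, partialDeriv i (partialDeriv i η) x) * w x) :
    ∃ K : ℝ, 0 ≤ K ∧ ∀ᵐ x, w x ≤ K * ∫ y, heat 0 x y * w y := by
  set v₁ := volume.real (Metric.closedBall (0 : Space d) 1) with hv
  have hvpos : 0 < v₁ := ENNReal.toReal_pos (Metric.measure_closedBall_pos _ _ one_pos).ne'
    measure_closedBall_lt_top.ne
  refine ⟨v₁⁻¹ * (Real.exp (1 / 4) * Real.exp μ), by positivity, ?_⟩
  filter_upwards [IsUnifLocDoublingMeasure.ae_tendsto_average volume hw.locallyIntegrable 1]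
    with x hx
  have hlim : Tendsto (fun n : ℕ => Real.exp (-(n : ℝ))) atTop (𝓝[>] 0) :=
    tendsto_nhdsWithin_iff.2 ⟨Real.tendsto_exp_neg_atTop_nhds_zero.comp tendsto_natCast_atTop_atTop,
      Eventually.of_forall fun n => Real.exp_pos _⟩
  refine le_of_tendsto (hx (fun _ => x) _ hlim (Eventually.of_forall fun n =>
    Metric.mem_closedBall_self (by positivity))) (Eventually.of_forall fun n => ?_)
  rw [setAverage_eq, smul_eq_mul]
  have hvol : volume.real (Metric.closedBall x (Real.exp (-(n : ℝ))))
      = Real.exp (-(n : ℝ)) ^ d * v₁ := by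
    rw [hv, measureReal_def, measureReal_def, ← mul_one (Real.exp _),
      Measure.addHaar_closedBall_mul_of_pos _ _ (Real.exp_pos _), ENNReal.toReal_mul,
      ENNReal.toReal_ofReal (by positivity)]
    simp
  -- On the ball of radius `r = exp(-n)` the kernel at time `r²` is at least `r^(-d) exp(-1/4)`, so
  -- a ball average is controlled by a heat average.
  have hle : ∫ y in Metric.closedBall x (Real.exp (-(n : ℝ))), w y
      ≤ Real.exp (-(n : ℝ)) ^ d * (Real.exp (1 / 4) * ∫ y, heat (-n) x y * w y) := by
    rw [← integral_const_mul, ← integral_const_mul]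
    have hi := ((integrable_heat_mul hw (-n) x).const_mul (Real.exp (1 / 4))).const_mul
      (Real.exp (-(n : ℝ)) ^ d)
    refine (setIntegral_mono_on hw.integrableOn hi.integrableOn measurableSet_closedBall
      fun y hy => ?_).trans (setIntegral_le_integral hi (ae_of_all _ fun y => ?_))
    · rw [← mul_assoc, ← mul_assoc]
      refine le_mul_of_one_le_left (hw0 y) ?_
      rw [← Real.exp_nat_mul, heat_eq_exp, ← Real.exp_add, ← Real.exp_add]
      refine Real.one_le_exp ?_
      rw [mem_closedBall_iff_norm] at hy
      have h2 : ‖y - x‖ ^ 2 ≤ Real.exp (-(n : ℝ)) ^ 2 := by gcongr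
      have h3 : Real.exp (-(2 * -(n : ℝ))) * Real.exp (-(n : ℝ)) ^ 2 = 1 := by
        rw [sq, ← Real.exp_add, ← Real.exp_add]; ring_nf; simp
      nlinarith [mul_le_mul_of_nonneg_left h2 (Real.exp_pos (-(2 * -(n : ℝ)))).le]
    · have := gauss_pos (-(d * (-n : ℝ))) (Real.exp (-(2 * (-n : ℝ))) / 4) x y
      have h0 := hw0 y
      simp only [Pi.zero_apply, heat]
      positivity
  have hm := integral_heat_mul_le hμ hw0 hw hsub x (τ := -n) (by simp)
  calc _ ≤ (volume.real (Metric.closedBall x (Real.exp (-(n : ℝ)))))⁻¹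
        * (Real.exp (-(n : ℝ)) ^ d * (Real.exp (1 / 4) * ∫ y, heat (-n) x y * w y)) := by gcongr
    _ = v₁⁻¹ * (Real.exp (1 / 4) * ∫ y, heat (-n) x y * w y) := by
        rw [hvol]
        have := (Real.exp_pos (-(n : ℝ))).ne'
        field_simp
    _ ≤ v₁⁻¹ * (Real.exp (1 / 4) * (Real.exp μ * ∫ y, heat 0 x y * w y)) := by gcongr
    _ = _ := by ring

end Subsolution

/-! ### From exponential moments to pointwise decay -/

/-- By `|a·(y - x)| ≤ |a|² + |y - x|²/4`, the Gaussian pays for replacing `y` by `x` in both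
`exp(-a·y)` and `exp(a·y)`, hence in the denominator of `cutExp`. -/
theorem heat_zero_le (a x y : Space d) {δ : ℝ} (hδ : 0 < δ) :
    heat 0 x y ≤ Real.exp (‖a‖ ^ 2) * (Real.exp (-inner ℝ a x) + δ * Real.exp (inner ℝ a x))
      * cutExp δ (inner ℝ a y) := by
  rw [cutExp, ← div_eq_mul_inv, le_div_iff₀ (cutExp_den_pos hδ _), heat_eq_exp]
  have hz : |inner ℝ a (y - x)| ≤ ‖a‖ ^ 2 + ‖y - x‖ ^ 2 / 4 := by
    refine (abs_real_inner_le_norm a (y - x)).trans ?_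
    nlinarith [sq_nonneg (‖a‖ - ‖y - x‖ / 2)]
  rw [inner_sub_right, abs_le] at hz
  have h1 : Real.exp (-(‖y - x‖ ^ 2 / 4)) * Real.exp (-inner ℝ a y)
      ≤ Real.exp (‖a‖ ^ 2) * Real.exp (-inner ℝ a x) := by
    rw [← Real.exp_add, ← Real.exp_add]
    exact Real.exp_le_exp.2 (by linarith)
  have h2 : Real.exp (-(‖y - x‖ ^ 2 / 4)) * Real.exp (inner ℝ a y)
      ≤ Real.exp (‖a‖ ^ 2) * Real.exp (inner ℝ a x) := by
    rw [← Real.exp_add, ← Real.exp_add]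
    exact Real.exp_le_exp.2 (by linarith)
  have e : -((d : ℝ) * 0) - Real.exp (-(2 * 0)) / 4 * ‖y - x‖ ^ 2 = -(‖y - x‖ ^ 2 / 4) := by
    simp; ring
  rw [e]
  nlinarith [mul_le_mul_of_nonneg_left h2 hδ.le]

/-- Exponential decay of the density of a ground state in every direction. -/
theorem IsGroundState.normSq_le_exp_inner {V : Space d → ℝ} {β : ℝ} {φ : Space d → ℂ}
    (hV : ∀ᵐ x, 0 ≤ V x) (hconf : IsConfining V) (hβ : 0 ≤ β) (hφ : IsGroundState V β φ)
    (a : Space d) :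
    ∃ C : ℝ, ∀ᵐ x, ‖φ x‖ ^ 2 ≤ C * Real.exp (-inner ℝ a x) := by
  obtain ⟨μ, hμ, hsub⟩ := hφ.exists_subsolution hV hβ
  have hw : Integrable fun x => ‖φ x‖ ^ 2 := hφ.1.1.1.integrable_norm_pow (by simp)
  have hVw : Integrable fun x => V x * ‖φ x‖ ^ 2 := hφ.1.2.1
  have hw0 : ∀ x, 0 ≤ ‖φ x‖ ^ 2 := fun x => by positivity
  obtain ⟨K, hK⟩ := exists_integral_cutExp_mul_le hV hconf hμ hw0 hw hVw hsub a
  obtain ⟨D, hD0, hD⟩ := exists_ae_le_integral_heat_mul (μ := 4 * μ) (by positivity) hw0 hw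
    fun η C hη h0 => by
      have h := hsub η C hη h0
      have hp : 0 ≤ ∫ x, η x * (V x * ‖φ x‖ ^ 2) := by
        refine integral_nonneg_of_ae ?_
        filter_upwards [hV] with x hx
        exact mul_nonneg (h0 x) (mul_nonneg hx (hw0 x))
      linarith
  refine ⟨D * (Real.exp (‖a‖ ^ 2) * K), ?_⟩
  filter_upwards [hD] with x hx
  have hδ : ∀ δ : ℝ, 0 < δ → ∫ y, heat 0 x y * ‖φ y‖ ^ 2
      ≤ Real.exp (‖a‖ ^ 2) * (Real.exp (-inner ℝ a x) + δ * Real.exp (inner ℝ a x)) * K := by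
    intro δ hδ
    have ht := isBoundedTest_cutExp_inner a hδ
    calc ∫ y, heat 0 x y * ‖φ y‖ ^ 2
        ≤ ∫ y, Real.exp (‖a‖ ^ 2) * (Real.exp (-inner ℝ a x) + δ * Real.exp (inner ℝ a x))
          * (cutExp δ (inner ℝ a y) * ‖φ y‖ ^ 2) := by
          refine integral_mono (integrable_heat_mul hw 0 x)
            ((integrable_bounded_mul ht.contDiff.continuous ht.bound hw).const_mul _) fun y => ?_
          rw [← mul_assoc]
          exact mul_le_mul_of_nonneg_right (heat_zero_le a x y hδ) (hw0 y)
      _ ≤ _ := by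
          rw [integral_const_mul]
          exact mul_le_mul_of_nonneg_left (hK δ hδ) (by positivity)
  -- The moment bound `K` does not depend on `δ`, so `δ → 0` can be taken at fixed `x`, removing the
  -- growing exponential.
  have hlim : Tendsto (fun δ : ℝ => Real.exp (‖a‖ ^ 2)
      * (Real.exp (-inner ℝ a x) + δ * Real.exp (inner ℝ a x)) * K) (𝓝[>] 0)
      (𝓝 (Real.exp (‖a‖ ^ 2) * (Real.exp (-inner ℝ a x) + 0 * Real.exp (inner ℝ a x)) * K)) :=
    (Continuous.tendsto (by fun_prop) 0).mono_left nhdsWithin_le_nhds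
  have hle := ge_of_tendsto hlim (eventually_mem_nhdsWithin.mono fun δ h => hδ δ h)
  calc ‖φ x‖ ^ 2 ≤ D * ∫ y, heat 0 x y * ‖φ y‖ ^ 2 := hx
    _ ≤ D * (Real.exp (‖a‖ ^ 2) * (Real.exp (-inner ℝ a x) + 0 * Real.exp (inner ℝ a x)) * K) := by
        gcongr
    _ = _ := by ring

theorem exists_norm_le_card_mul_abs (hd : 0 < d) (x : Space d) : ∃ i, ‖x‖ ≤ d * |x i| := by
  have hd' : (0 : ℝ) < d := Nat.cast_pos.2 hd
  have hsum : ‖x‖ ≤ ∑ i, |x i| := by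
    rw [EuclideanSpace.norm_eq, Real.sqrt_le_left (Finset.sum_nonneg fun i _ => abs_nonneg _)]
    exact Finset.sum_sq_le_sq_sum_of_nonneg fun i _ => abs_nonneg _
  have hne : (Finset.univ : Finset (Fin d)).Nonempty := ⟨⟨0, hd⟩, Finset.mem_univ _⟩
  obtain ⟨i, -, hi⟩ := Finset.exists_le_of_sum_le hne
    (f := fun _ => ‖x‖ / d) (g := fun i => |x i|) (by
      simpa [mul_div_cancel₀ _ hd'.ne'] using hsum)
  exact ⟨i, by rwa [div_le_iff₀' hd'] at hi⟩

end GrossPitaevskii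

end

theorem mainTheorem6 (d : ℕ) (hd : d = 1 ∨ d = 2 ∨ d = 3)
    (V : GrossPitaevskii.Space d → ℝ)
    (hV_nonneg : ∀ᵐ x, 0 ≤ V x)
    (hV_loc : GrossPitaevskii.MemL2Loc V)
    (hV_conf : GrossPitaevskii.IsConfining V)
    (β : ℝ) (hβ : 0 ≤ β)
    (φ : GrossPitaevskii.Space d → ℂ)
    (hφ : GrossPitaevskii.IsGroundState V β φ) :
    ∀ ν : ℝ, 0 < ν → ∃ C : ℝ, 0 < C ∧
      ∀ᵐ x, ‖φ x‖ ≤ C * Real.exp (-ν * ‖x‖) := by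
  intro ν hν
  have hd0 : 0 < d := by omega
  have hdec := fun (t : ℝ) (i : Fin d) =>
    hφ.normSq_le_exp_inner hV_nonneg hV_conf hβ (EuclideanSpace.single i t)
  choose C hC using hdec
  -- The factor `d` pays for `‖x‖ ≤ d|xᵢ|`, and the factor `2` for the square root taken at the end.
  set t := 2 * ν * d with ht
  set D := 1 + ∑ i, (|C t i| + |C (-t) i|) with hD
  have hD0 : 0 < D := by positivity
  refine ⟨√D, Real.sqrt_pos.2 hD0, ?_⟩
  filter_upwards [ae_all_iff.2 (hC t), ae_all_iff.2 (hC (-t))] with x h1 h2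
  obtain ⟨i, hi⟩ := GrossPitaevskii.exists_norm_le_card_mul_abs hd0 x
  have hsum : |C t i| + |C (-t) i| ≤ ∑ i, (|C t i| + |C (-t) i|) :=
    Finset.single_le_sum (f := fun i => |C t i| + |C (-t) i|) (fun i _ => by positivity)
      (Finset.mem_univ i)
  have hCt : C t i ≤ D := by linarith [le_abs_self (C t i), abs_nonneg (C (-t) i)]
  have hCt' : C (-t) i ≤ D := by linarith [le_abs_self (C (-t) i), abs_nonneg (C t i)]
  have hexp : ‖φ x‖ ^ 2 ≤ D * Real.exp (-(t * |x i|)) := by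
    rcases abs_cases (x i) with ⟨h, -⟩ | ⟨h, -⟩
    · refine (h1 i).trans ?_
      rw [EuclideanSpace.inner_single_left, h]
      simpa using mul_le_mul_of_nonneg_right hCt (Real.exp_pos _).le
    · refine (h2 i).trans ?_
      rw [EuclideanSpace.inner_single_left, h]
      simpa using mul_le_mul_of_nonneg_right hCt' (Real.exp_pos _).le
  refine abs_le_of_sq_le_sq' ?_ (by positivity) |>.2
  rw [mul_pow, Real.sq_sqrt hD0.le, ← Real.exp_nat_mul]
  refine hexp.trans (mul_le_mul_of_nonneg_left (Real.exp_le_exp.2 ?_) hD0.le)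
  have := mul_le_mul_of_nonneg_left hi (by positivity : 0 ≤ 2 * ν)
  push_cast
  rw [ht]
  linarith
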